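/- Weighted $L^1$ Poincaré inequality. Let $\Omega \subset \mathbb{R}^d$ be an open convex set with finite (Euclidean) diameter $\mathrm{diam}(\Omega)$. Let $p : \Omega \to [0,\infty)$ be a twice continuously differentiable log-concave function, i.e. $p(ax+by) \ge p(x)^a p(y)^b$ for all $x,y\in\Omega$ and all $a,b>0$ with $a+b=1$. Let $u \in W^{1,1}(\Omega)$, i.e. $u : \Omega \to \mathbb{R}$ is in $L^1(\Omega)$ and has a weak gradient $\nabla u \in L^1(\Omega;\mathbb{R}^d)$, and suppose that $\int_\Omega u(z)\,p(z)\,dz = 0$. Then $|u|\,p$ and $\|\nabla u\|\,p$ are integrable on $\Omega$ and $$\int_\Omega |u(z)|\,p(z)\,dz \;\le\; 2\,\mathrm{diam}(\Omega)\int_\Omega \|\nabla u(z)\|\,p(z)\,dz,$$ where $\|\cdot\|$ is the Euclidean norm. -/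

import Mathlib

open MeasureTheory
open scoped ContDiff

/-- `p` satisfies the log-concavity inequality on `s` (meant for a convex set `s` and a weight `p`
that is nonnegative on `s`; the weight may vanish, that is, `log p = -∞` is allowed). -/
def LogConcaveOn {E : Type*} [AddCommGroup E] [Module ℝ E] (s : Set E) (p : E → ℝ) : Prop :=
  ∀ ⦃x : E⦄, x ∈ s → ∀ ⦃y : E⦄, y ∈ s → ∀ ⦃a b : ℝ⦄, 0 < a → 0 < b → a + b = 1 →
    p x ^ a * p y ^ b ≤ p (a • x + b • y)

/-- `g` is a weak (distributional) gradient of `u` on the open set `Ω ⊆ ℝᵈ`: both are locally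
integrable on `Ω`, and `∫ u ∂ᵢφ = - ∫ gᵢ φ` for every smooth `φ` with compact support in `Ω` and
every coordinate `i`. -/
structure HasWeakGradientOn {d : ℕ} (Ω : Set (EuclideanSpace ℝ (Fin d)))
    (u : EuclideanSpace ℝ (Fin d) → ℝ)
    (g : EuclideanSpace ℝ (Fin d) → EuclideanSpace ℝ (Fin d)) : Prop where
  locallyIntegrableOn_fun : LocallyIntegrableOn u Ω volume
  locallyIntegrableOn_grad : LocallyIntegrableOn g Ω volume
  integral_eq : ∀ φ : EuclideanSpace ℝ (Fin d) → ℝ,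
    ContDiff ℝ ∞ φ → HasCompactSupport φ → tsupport φ ⊆ Ω → ∀ i : Fin d,
      ∫ x in Ω, u x * fderiv ℝ φ x (EuclideanSpace.single i 1) = - ∫ x in Ω, g x i * φ x

/-- `u` belongs to the Sobolev space `W^{1,1}(Ω)`: `u ∈ L¹(Ω)` and `u` has a weak gradient in
`L¹(Ω; ℝᵈ)`. -/
def MemSobolevW11 {d : ℕ} (Ω : Set (EuclideanSpace ℝ (Fin d)))
    (u : EuclideanSpace ℝ (Fin d) → ℝ) : Prop :=
  IntegrableOn u Ω volume ∧
    ∃ g : EuclideanSpace ℝ (Fin d) → EuclideanSpace ℝ (Fin d),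
      HasWeakGradientOn Ω u g ∧ IntegrableOn g Ω volume

/-!
The proof is a functional form of Bobkov's derivation of isoperimetric inequalities for log-concave
measures from the Prékopa–Leindler inequality; its constants do not depend on the dimension.

Let `μ = p dx` on a convex set `S` of diameter at most `D`, with total mass `P`. Moving a point of
`S` by the factor `t` towards another point of `S` displaces it by at most `t * D`. Hence, for
smooth `w`, the function `F = w + t * D * (‖∇w‖ + η)` satisfies `w x ≤ F ((1 - t) • x + t • y)` for
small `t`. Prékopa–Leindler for `w⁺ p`, `p` and `(F⁺) ^ (1 - t) p`, followed by Hölder's inequality,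
gives `(∫ w⁺) ^ (1 - t) * P ^ t ≤ (∫ F⁺) ^ (1 - t) * μ {F > 0} ^ t`
(`lintegral_rpow_mul_measure_univ_le`). The derivative of this relation at `t = 0` is
`(∫ w⁺) * μ {w < 0} ≤ P * D * ∫_{w > 0} ‖∇w‖`, as long as `μ {w = 0} = 0`
(`integral_posPart_mul_measureReal_neg_le`). Adding the same inequality for `-w` yields
`min (∫ w⁺) (∫ w⁻) ≤ D * ∫ ‖∇w‖`, which is `∫ |w| ≤ |∫ w| + 2 * D * ∫ ‖∇w‖`. Since all but countably
many level sets of a function are null, the restriction on `{w = 0}` can be removed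
(`integral_abs_le_of_uniformContinuous_fderiv`).

A Sobolev function is mollified on the inner parallel sets of `Ω`, which are convex
(`setIntegral_abs_mul_le_of_ball_subset`). Fatou's lemma handles the left-hand side. On the right,
the mollifier is moved onto the weight, which is bounded by log-concavity
(`LogConcaveOn.exists_forall_le`), so that dominated convergence applies. Finally the parallel sets
exhaust `Ω`.
-/

open Set Filter Topology
open scoped ENNReal Pointwise Convolution

/-! ### The Prékopa–Leindler inequality -/

/-- The one-dimensional Brunn–Minkowski inequality for compact sets. -/
theorem volume_add_volume_le_of_isCompact {K L : Set ℝ} (hK : IsCompact K) (hL : IsCompact L)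
    (hK₀ : K.Nonempty) (hL₀ : L.Nonempty) : volume K + volume L ≤ volume (K + L) := by
  obtain ⟨a, haK, ha⟩ := hK.exists_isGreatest hK₀
  obtain ⟨b, hbL, hb⟩ := hL.exists_isLeast hL₀
  have h₁ : volume (b +ᵥ K) = volume K := measure_vadd _ _ _
  have h₂ : volume (a +ᵥ L) = volume L := measure_vadd _ _ _
  have hsub : (b +ᵥ K) ∪ (a +ᵥ L) ⊆ K + L := by
    rintro _ (⟨x, hx, rfl⟩ | ⟨y, hy, rfl⟩)
    · exact ⟨x, hx, b, hbL, add_comm _ _⟩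
    · exact ⟨a, haK, y, hy, rfl⟩
  -- The two translates lie on either side of `a + b`.
  have hinter : (b +ᵥ K) ∩ (a +ᵥ L) ⊆ {a + b} := by
    rintro _ ⟨⟨x, hx, rfl⟩, ⟨y, hy, hxy⟩⟩
    have h1 := ha hx
    have h2 := hb hy
    simp only [vadd_eq_add, mem_singleton_iff] at hxy ⊢
    linarith
  have hdisj : AEDisjoint volume (b +ᵥ K) (a +ᵥ L) :=
    measure_mono_null hinter (by simp)
  rw [← h₁, ← h₂, ← measure_union₀ ?_ hdisj]
  · exact measure_mono hsub
  · exact (hL.vadd a).measurableSet.nullMeasurableSet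

/-- The one-dimensional Brunn–Minkowski inequality for convex combinations. It is stated for
supersets `C` of `s • A + t • B`, since that sum need not be measurable. -/
theorem ofReal_mul_volume_add_le {A B C : Set ℝ} (hA : MeasurableSet A) (hB : MeasurableSet B)
    (hA₀ : A.Nonempty) (hB₀ : B.Nonempty) {s t : ℝ} (hs : 0 < s) (ht : 0 < t)
    (h : ∀ x ∈ A, ∀ y ∈ B, s * x + t * y ∈ C) :
    ENNReal.ofReal s * volume A + ENNReal.ofReal t * volume B ≤ volume C := by
  have hsA : ENNReal.ofReal s * volume A = volume (s • A) := by
    rw [Measure.addHaar_smul]; simp [abs_of_pos hs]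
  have htB : ENNReal.ofReal t * volume B = volume (t • B) := by
    rw [Measure.addHaar_smul]; simp [abs_of_pos ht]
  obtain ⟨a, ha⟩ := hA₀
  obtain ⟨b, hb⟩ := hB₀
  rw [hsA, htB, (hA.const_smul₀ s).measure_eq_iSup_isCompact,
    (hB.const_smul₀ t).measure_eq_iSup_isCompact]
  simp only [iSup_and']
  refine ENNReal.biSup_add_biSup_le' ⟨∅, by simp⟩ ⟨∅, by simp⟩ ?_
  rintro K ⟨hKA, hK⟩ L ⟨hLB, hL⟩
  calc volume K + volume L ≤ volume (insert (s * a) K) + volume (insert (t * b) L) := by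
        gcongr <;> exact subset_insert _ _
    _ ≤ volume (insert (s * a) K + insert (t * b) L) :=
        volume_add_volume_le_of_isCompact (hK.insert _) (hL.insert _) (insert_nonempty _ _)
          (insert_nonempty _ _)
    _ ≤ volume C := by
        refine measure_mono ?_
        have hKA' : insert (s * a) K ⊆ s • A :=
          insert_subset ⟨a, ha, rfl⟩ hKA
        have hLB' : insert (t * b) L ⊆ t • B :=
          insert_subset ⟨b, hb, rfl⟩ hLB
        rintro _ ⟨x, hx, y, hy, rfl⟩
        obtain ⟨x', hx', rfl⟩ := hKA' hx
        obtain ⟨y', hy', rfl⟩ := hLB' hy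
        exact h x' hx' y' hy'

/-- The layer cake formula for a function with values in `[0, 1]`. -/
theorem lintegral_eq_setLIntegral_Ioo_measure_lt {α : Type*} [MeasurableSpace α] (μ : Measure α)
    {f : α → ℝ≥0∞} (hf : Measurable f) (hf₁ : ∀ x, f x ≤ 1) :
    ∫⁻ x, f x ∂μ = ∫⁻ τ in Ioo (0 : ℝ) 1, μ {x | ENNReal.ofReal τ < f x} := by
  have hfin : ∀ x, f x ≠ ⊤ := fun x => ne_top_of_le_ne_top ENNReal.one_ne_top (hf₁ x)
  have h := lintegral_eq_lintegral_meas_lt μ (f := fun x => (f x).toReal)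
    (Eventually.of_forall fun _ => ENNReal.toReal_nonneg) hf.ennreal_toReal.aemeasurable
  simp only [ENNReal.ofReal_toReal (hfin _)] at h
  rw [h, ← lintegral_indicator measurableSet_Ioi, ← lintegral_indicator measurableSet_Ioo]
  congr 1 with τ
  by_cases h0 : 0 < τ
  · rw [indicator_of_mem (show τ ∈ Ioi 0 from h0)]
    have : {x | ENNReal.ofReal τ < f x} = {x | τ < (f x).toReal} := by
      ext x
      exact ENNReal.ofReal_lt_iff_lt_toReal h0.le (hfin x)
    by_cases h1 : τ < 1
    · rw [indicator_of_mem (show τ ∈ Ioo 0 1 from ⟨h0, h1⟩), this]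
    · rw [indicator_of_notMem (fun hτ : τ ∈ Ioo 0 1 => h1 hτ.2)]
      have : {x | τ < (f x).toReal} = ∅ := by
        ext x
        have : (f x).toReal ≤ 1 := ENNReal.toReal_le_of_le_ofReal zero_le_one (by simpa using hf₁ x)
        simp only [mem_ofPred_eq, mem_empty_iff_false, iff_false]
        linarith
      rw [this, measure_empty]
  · rw [indicator_of_notMem (fun hτ : τ ∈ Ioi 0 => h0 hτ),
      indicator_of_notMem (fun hτ : τ ∈ Ioo 0 1 => h0 hτ.1)]

/-- The weighted inequality of arithmetic and geometric means on `[0, ∞]`. -/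
theorem ENNReal.rpow_mul_rpow_le_add {s t : ℝ} (hs : 0 < s) (ht : 0 < t) (hst : s + t = 1)
    (a b : ℝ≥0∞) : a ^ s * b ^ t ≤ ENNReal.ofReal s * a + ENNReal.ofReal t * b := by
  rcases eq_or_ne a ⊤ with rfl | ha
  · simp [ENNReal.mul_top, hs]
  rcases eq_or_ne b ⊤ with rfl | hb
  · simp [ENNReal.mul_top, ht]
  lift a to NNReal using ha
  lift b to NNReal using hb
  have := NNReal.geom_mean_le_arith_mean2_weighted s.toNNReal t.toNNReal a b (by
    rw [← Real.toNNReal_add hs.le ht.le, hst, Real.toNNReal_one])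
  rw [Real.coe_toNNReal _ hs.le, Real.coe_toNNReal _ ht.le] at this
  rw [← ENNReal.coe_rpow_of_nonneg _ hs.le, ← ENNReal.coe_rpow_of_nonneg _ ht.le]
  rw [ENNReal.ofReal, ENNReal.ofReal]
  exact_mod_cast this

/-- A measure `μ` satisfies the Prékopa–Leindler inequality: the integral of `h` dominates the
geometric mean of the integrals of `f` and `g` as soon as `h` dominates the geometric means of the
values of `f` and `g`. Asking `h` to be measurable avoids sup-convolutions. -/
def PrekopaLeindler {V : Type*} [AddCommGroup V] [Module ℝ V] [MeasurableSpace V]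
    (μ : Measure V) : Prop :=
  ∀ ⦃s t : ℝ⦄, 0 < s → 0 < t → s + t = 1 → ∀ ⦃f g h : V → ℝ≥0∞⦄,
    Measurable f → Measurable g → Measurable h →
    (∀ x y, f x ^ s * g y ^ t ≤ h (s • x + t • y)) →
    (∫⁻ x, f x ∂μ) ^ s * (∫⁻ x, g x ∂μ) ^ t ≤ ∫⁻ x, h x ∂μ

/-- The case in which both functions have supremum `1`: all superlevel sets below the level `1` are
nonempty, so that Brunn–Minkowski applies at each level. -/
theorem lintegral_add_le_of_iSup_eq_one {s t : ℝ} (hs : 0 < s) (ht : 0 < t) (hst : s + t = 1)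
    {f g h : ℝ → ℝ≥0∞} (hf : Measurable f) (hg : Measurable g) (hh : Measurable h)
    (hf₁ : ⨆ x, f x = 1) (hg₁ : ⨆ x, g x = 1)
    (hfgh : ∀ x y, f x ^ s * g y ^ t ≤ h (s * x + t * y)) :
    ENNReal.ofReal s * (∫⁻ x, f x) + ENNReal.ofReal t * (∫⁻ x, g x) ≤ ∫⁻ x, h x := by
  have hfle : ∀ x, f x ≤ 1 := fun x => hf₁ ▸ le_iSup f x
  have hgle : ∀ x, g x ≤ 1 := fun x => hg₁ ▸ le_iSup g x
  have hanti : ∀ k : ℝ → ℝ≥0∞, Measurable fun τ : ℝ => volume {x | ENNReal.ofReal τ < k x} :=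
    fun k => Antitone.measurable fun a b hab => measure_mono fun x hx =>
      (ENNReal.ofReal_le_ofReal hab).trans_lt hx
  calc ENNReal.ofReal s * (∫⁻ x, f x) + ENNReal.ofReal t * (∫⁻ x, g x)
      = ∫⁻ τ in Ioo (0 : ℝ) 1, (ENNReal.ofReal s * volume {x | ENNReal.ofReal τ < f x} +
          ENNReal.ofReal t * volume {x | ENNReal.ofReal τ < g x}) := by
        rw [lintegral_eq_setLIntegral_Ioo_measure_lt _ hf hfle,
          lintegral_eq_setLIntegral_Ioo_measure_lt _ hg hgle,
          lintegral_add_left ((hanti f).const_mul _), lintegral_const_mul _ (hanti f),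
          lintegral_const_mul _ (hanti g)]
    _ ≤ ∫⁻ τ in Ioo (0 : ℝ) 1, volume {x | ENNReal.ofReal τ < min (h x) 1} := by
        refine setLIntegral_mono_ae' measurableSet_Ioo (Eventually.of_forall fun τ hτ => ?_)
        have hτ1 : ENNReal.ofReal τ < 1 := by
          rw [← ENNReal.ofReal_one]; exact (ENNReal.ofReal_lt_ofReal_iff one_pos).2 hτ.2
        refine ofReal_mul_volume_add_le (measurableSet_lt measurable_const hf)
          (measurableSet_lt measurable_const hg) (lt_iSup_iff.1 (hτ1.trans_eq hf₁.symm) :)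
          (lt_iSup_iff.1 (hτ1.trans_eq hg₁.symm) :) hs ht fun x hx y hy => lt_min ?_ hτ1
        refine lt_of_lt_of_le ?_ (hfgh x y)
        have hpos : ENNReal.ofReal τ ≠ 0 := by simpa using hτ.1
        calc ENNReal.ofReal τ = ENNReal.ofReal τ ^ s * ENNReal.ofReal τ ^ t := by
              rw [← ENNReal.rpow_add _ _ hpos ENNReal.ofReal_ne_top, hst, ENNReal.rpow_one]
          _ < f x ^ s * g y ^ t :=
              ENNReal.mul_lt_mul (ENNReal.rpow_lt_rpow hx hs) (ENNReal.rpow_lt_rpow hy ht)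
    _ = ∫⁻ x, min (h x) 1 :=
        (lintegral_eq_setLIntegral_Ioo_measure_lt _ (hh.min measurable_const)
          fun x => min_le_right _ _).symm
    _ ≤ ∫⁻ x, h x := lintegral_mono fun x => min_le_left _ _

/-- The one-dimensional inequality for functions with finite suprema `A` and `B`, by rescaling to
supremum `1`. -/
theorem lintegral_rpow_mul_le_of_iSup_ne_top {s t : ℝ} (hs : 0 < s) (ht : 0 < t) (hst : s + t = 1)
    {f g h : ℝ → ℝ≥0∞} (hf : Measurable f) (hg : Measurable g) (hh : Measurable h)
    (hA : ⨆ x, f x ≠ ⊤) (hB : ⨆ x, g x ≠ ⊤)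
    (hfgh : ∀ x y, f x ^ s * g y ^ t ≤ h (s * x + t * y)) :
    (∫⁻ x, f x) ^ s * (∫⁻ x, g x) ^ t ≤ ∫⁻ x, h x := by
  set A := ⨆ x, f x with hAdef
  set B := ⨆ x, g x with hBdef
  rcases eq_or_ne A 0 with hA0 | hA0
  · have : ∀ x, f x = 0 := fun x => le_antisymm (hA0 ▸ le_iSup f x) bot_le
    simp [this, hs]
  rcases eq_or_ne B 0 with hB0 | hB0
  · have : ∀ x, g x = 0 := fun x => le_antisymm (hB0 ▸ le_iSup g x) bot_le
    simp [this, ht]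
  set c := A ^ s * B ^ t with hc
  have hAs : A ^ s ≠ 0 := by simp [hA0, hA]
  have hBt : B ^ t ≠ 0 := by simp [hB0, hB]
  have hAs' : A ^ s ≠ ⊤ := by simp [hA, hs.le]
  have hBt' : B ^ t ≠ ⊤ := by simp [hB, ht.le]
  have hc0 : c ≠ 0 := mul_ne_zero hAs hBt
  have hc1 : c ≠ ⊤ := ENNReal.mul_ne_top hAs' hBt'
  have hcinv : c⁻¹ = (A⁻¹) ^ s * (B⁻¹) ^ t := by
    rw [hc, ENNReal.mul_inv (Or.inl hAs) (Or.inl hAs'), ENNReal.inv_rpow, ENNReal.inv_rpow]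
  have key := lintegral_add_le_of_iSup_eq_one hs ht hst (hf.const_mul A⁻¹) (hg.const_mul B⁻¹)
    (hh.const_mul c⁻¹) (by rw [← ENNReal.mul_iSup, ENNReal.inv_mul_cancel hA0 hA])
    (by rw [← ENNReal.mul_iSup, ENNReal.inv_mul_cancel hB0 hB]) (fun x y => by
      rw [ENNReal.mul_rpow_of_nonneg _ _ hs.le, ENNReal.mul_rpow_of_nonneg _ _ ht.le, hcinv,
        mul_mul_mul_comm]
      gcongr
      exact hfgh x y)
  have key2 := (ENNReal.rpow_mul_rpow_le_add hs ht hst _ _).trans key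
  rw [lintegral_const_mul _ hf, lintegral_const_mul _ hg, lintegral_const_mul _ hh,
    ENNReal.mul_rpow_of_nonneg _ _ hs.le, ENNReal.mul_rpow_of_nonneg _ _ ht.le,
    mul_mul_mul_comm, ← hcinv] at key2
  exact (ENNReal.mul_le_mul_iff_right (ENNReal.inv_ne_zero.2 hc1) (ENNReal.inv_ne_top.2 hc0)).1 key2

theorem prekopaLeindler_real : PrekopaLeindler (volume : Measure ℝ) := by
  intro s t hs ht hst f g h hf hg hh hfgh
  have hmono : ∀ k : ℝ → ℝ≥0∞, Measurable k →
      Tendsto (fun n : ℕ => ∫⁻ x, min (k x) n) atTop (𝓝 (∫⁻ x, k x)) := by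
    intro k hk
    refine lintegral_tendsto_of_tendsto_of_monotone
      (fun n => (hk.min measurable_const).aemeasurable)
      (Eventually.of_forall fun x m n hmn => min_le_min_left _ (by exact_mod_cast hmn))
      (Eventually.of_forall fun x => ?_)
    have := (tendsto_const_nhds (x := k x)).min ENNReal.tendsto_nat_nhds_top
    simpa using this
  have hbdd : ∀ (k : ℝ → ℝ≥0∞) (n : ℕ), ⨆ x, min (k x) n ≠ ⊤ := fun k n =>
    ne_top_of_le_ne_top (ENNReal.natCast_ne_top n) (iSup_le fun x => min_le_right _ _)
  have htrunc : ∀ m n : ℕ,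
      (∫⁻ x, min (f x) m) ^ s * (∫⁻ x, min (g x) n) ^ t ≤ ∫⁻ x, h x := fun m n =>
    lintegral_rpow_mul_le_of_iSup_ne_top hs ht hst (hf.min measurable_const)
      (hg.min measurable_const) hh (hbdd f m) (hbdd g n) fun x y => by
        refine le_trans ?_ (hfgh x y)
        gcongr <;> exact min_le_left _ _
  -- Multiplication on `ℝ≥0∞` is continuous away from `(0, ⊤)` and `(⊤, 0)`.
  rcases eq_or_ne (∫⁻ x, f x) 0 with hf0 | hf0
  · simp [hf0, hs]
  rcases eq_or_ne (∫⁻ x, g x) 0 with hg0 | hg0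
  · simp [hg0, ht]
  refine le_of_tendsto' (ENNReal.Tendsto.mul ((hmono f hf).ennrpow_const s) (Or.inl ?_)
    ((hmono g hg).ennrpow_const t) (Or.inl ?_)) (fun n => htrunc n n)
  · simp [hf0, hs.le]
  · simp [hg0, ht.le]

/-- The inequality tensorizes: it is applied on the slices first, and then to the integrals over the
slices. -/
theorem PrekopaLeindler.prod {V W : Type*} [AddCommGroup V] [Module ℝ V] [MeasurableSpace V]
    [AddCommGroup W] [Module ℝ W] [MeasurableSpace W] {μ : Measure V} {ν : Measure W}
    [SFinite ν] (hμ : PrekopaLeindler μ) (hν : PrekopaLeindler ν) :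
    PrekopaLeindler (μ.prod ν) := by
  intro s t hs ht hst f g h hf hg hh hfgh
  rw [lintegral_prod _ hf.aemeasurable, lintegral_prod _ hg.aemeasurable,
    lintegral_prod _ hh.aemeasurable]
  refine hμ hs ht hst hf.lintegral_prod_right' hg.lintegral_prod_right' hh.lintegral_prod_right'
    fun x x' => ?_
  exact hν hs ht hst (hf.comp measurable_prodMk_left) (hg.comp measurable_prodMk_left)
    (hh.comp measurable_prodMk_left) fun y y' => hfgh (x, y) (x', y')

theorem PrekopaLeindler.of_measurePreserving {V W : Type*} [AddCommGroup V] [Module ℝ V]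
    [MeasurableSpace V] [AddCommGroup W] [Module ℝ W] [MeasurableSpace W] {μ : Measure V}
    {ν : Measure W} (hμ : PrekopaLeindler μ) (e : V →ₗ[ℝ] W) (he : MeasurePreserving e μ ν) :
    PrekopaLeindler ν := by
  intro s t hs ht hst f g h hf hg hh hfgh
  rw [← he.lintegral_comp hf, ← he.lintegral_comp hg, ← he.lintegral_comp hh]
  refine hμ hs ht hst (hf.comp he.measurable) (hg.comp he.measurable) (hh.comp he.measurable)
    fun x y => ?_
  simpa using hfgh (e x) (e y)

theorem prekopaLeindler_pi : ∀ n : ℕ, PrekopaLeindler (volume : Measure (Fin n → ℝ))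
  | 0 => by
    intro s t hs ht hst f g h hf hg hh hfgh
    have : (volume : Measure (Fin 0 → ℝ)) = Measure.dirac 0 := by
      rw [volume_pi, Measure.pi_of_empty _ 0]
    rw [this, lintegral_dirac' _ hf, lintegral_dirac' _ hg, lintegral_dirac' _ hh]
    simpa using hfgh 0 0
  | n + 1 => by
    have hprod := prekopaLeindler_real.prod (prekopaLeindler_pi n)
    refine hprod.of_measurePreserving (Fin.consLinearEquiv ℝ (fun _ : Fin (n + 1) => ℝ)).toLinearMap ?_
    have hmp := (volume_preserving_piFinSuccAbove (fun _ : Fin (n + 1) => ℝ) 0).symm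
    have hcons : ⇑(Fin.consLinearEquiv ℝ (fun _ : Fin (n + 1) => ℝ)).toLinearMap =
        (MeasurableEquiv.piFinSuccAbove (fun _ : Fin (n + 1) => ℝ) 0).symm := by
      funext x i
      refine Fin.cases ?_ (fun j => ?_) i <;> simp [MeasurableEquiv.piFinSuccAbove]
    rw [hcons]
    exact hmp

/-- The **Prékopa–Leindler inequality** for Lebesgue measure on Euclidean space. -/
theorem prekopaLeindler_euclideanSpace (d : ℕ) :
    PrekopaLeindler (volume : Measure (EuclideanSpace ℝ (Fin d))) :=
  (prekopaLeindler_pi d).of_measurePreserving (WithLp.linearEquiv 2 ℝ (Fin d → ℝ)).symm.toLinearMap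
    (PiLp.volume_preserving_toLp (Fin d))

section

variable {d : ℕ}

/-! ### The Poincaré inequality for smooth functions -/

theorem MeasureTheory.Integrable.real_posPart {α : Type*} [MeasurableSpace α] {μ : Measure α}
    {f : α → ℝ} (hf : Integrable f μ) : Integrable (fun x => (f x)⁺) μ :=
  hf.pos_part

theorem MeasureTheory.Integrable.real_negPart {α : Type*} [MeasurableSpace α] {μ : Measure α}
    {f : α → ℝ} (hf : Integrable f μ) : Integrable (fun x => (f x)⁻) μ :=
  hf.neg_part

/-- Consequence of Prékopa–Leindler for the log-concave measure `μ = p dx` on `S`, where `F` at the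
point `s • x + t • y` dominates `f` at `x`. The inequality is applied to `f * p`, `p` and
`F ^ s * p`, and Hölder's inequality on the support of `F` bounds the integral of the latter. -/
theorem lintegral_rpow_mul_measure_univ_le {S : Set (EuclideanSpace ℝ (Fin d))}
    (hS : MeasurableSet S) (hSc : Convex ℝ S) {p : EuclideanSpace ℝ (Fin d) → ℝ}
    (hpm : Measurable p) (hp₀ : ∀ x ∈ S, 0 ≤ p x) (hp : LogConcaveOn S p)
    {μ : Measure (EuclideanSpace ℝ (Fin d))}
    (hμ : μ = (volume.restrict S).withDensity fun x => ENNReal.ofReal (p x))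
    {s t : ℝ} (hs : 0 < s) (ht : 0 < t) (hst : s + t = 1)
    {f F : EuclideanSpace ℝ (Fin d) → ℝ≥0∞} (hf : Measurable f) (hF : Measurable F)
    (hfF : ∀ x ∈ S, ∀ y ∈ S, f x ≤ F (s • x + t • y)) :
    (∫⁻ x, f x ∂μ) ^ s * μ univ ^ t ≤ (∫⁻ x, F x ∂μ) ^ s * μ {x | F x ≠ 0} ^ t := by
  have hpm' : Measurable fun x => ENNReal.ofReal (p x) := hpm.ennreal_ofReal
  have hlint : ∀ k : EuclideanSpace ℝ (Fin d) → ℝ≥0∞, Measurable k →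
      ∫⁻ x, k x ∂μ = ∫⁻ x, S.indicator (fun x => ENNReal.ofReal (p x) * k x) x := by
    intro k hk
    rw [hμ, lintegral_withDensity_eq_lintegral_mul _ hpm' hk, lintegral_indicator hS]
    rfl
  have hFs : MeasurableSet {x | F x ≠ 0} := hF (measurableSet_singleton 0).compl
  set G : EuclideanSpace ℝ (Fin d) → ℝ≥0∞ := {x | F x ≠ 0}.indicator 1 with hG
  have hGm : Measurable G := measurable_one.indicator hFs
  have huniv : μ univ = ∫⁻ x, (1 : EuclideanSpace ℝ (Fin d) → ℝ≥0∞) x ∂μ := by simp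
  have hset : μ {x | F x ≠ 0} = ∫⁻ x, G x ∂μ := by simp [hG, lintegral_indicator hFs]
  rw [huniv, hset, hlint f hf, hlint 1 measurable_one, hlint F hF, hlint G hGm]
  have hm : ∀ k : EuclideanSpace ℝ (Fin d) → ℝ≥0∞, Measurable k →
      Measurable (S.indicator fun x => ENNReal.ofReal (p x) * k x) := fun k hk =>
    (hpm'.mul hk).indicator hS
  refine (prekopaLeindler_euclideanSpace d hs ht hst (hm f hf) (hm 1 measurable_one)
    (((hm F hF).pow_const s).mul ((hm G hGm).pow_const t)) fun x y => ?_).trans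
    (ENNReal.lintegral_mul_norm_pow_le (hm F hF).aemeasurable (hm G hGm).aemeasurable
      hs.le ht.le hst)
  by_cases hx : x ∈ S
  swap; · simp [hx, hs]
  by_cases hy : y ∈ S
  swap; · simp [hy, ht]
  have hz : s • x + t • y ∈ S := hSc hx hy hs.le ht.le hst
  simp only [indicator_of_mem hx, indicator_of_mem hy, indicator_of_mem hz, Pi.mul_apply,
    Pi.one_apply, mul_one]
  set z := s • x + t • y
  rcases eq_or_ne (f x) 0 with h0 | h0
  · simp [h0, hs]
  have hFz : F z ≠ 0 := fun h => h0 (le_antisymm (h ▸ hfF x hx y hy) bot_le)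
  have hGz : G z = 1 := by simp [hG, hFz]
  have hpz : ENNReal.ofReal (p x) ^ s * ENNReal.ofReal (p y) ^ t ≤ ENNReal.ofReal (p z) := by
    rw [ENNReal.ofReal_rpow_of_nonneg (hp₀ x hx) hs.le,
      ENNReal.ofReal_rpow_of_nonneg (hp₀ y hy) ht.le,
      ← ENNReal.ofReal_mul (Real.rpow_nonneg (hp₀ x hx) _)]
    exact ENNReal.ofReal_le_ofReal (hp hx hy hs ht hst)
  calc (ENNReal.ofReal (p x) * f x) ^ s * ENNReal.ofReal (p y) ^ t
      = ENNReal.ofReal (p x) ^ s * ENNReal.ofReal (p y) ^ t * f x ^ s := by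
        rw [ENNReal.mul_rpow_of_nonneg _ _ hs.le]; ring
    _ ≤ ENNReal.ofReal (p z) * F z ^ s := by
        gcongr
        exact hfF x hx y hy
    _ = ENNReal.ofReal (p z) ^ s * ENNReal.ofReal (p z) ^ t * F z ^ s := by
        rw [← ENNReal.rpow_add_of_nonneg _ _ hs.le ht.le, hst, ENNReal.rpow_one]
    _ = (ENNReal.ofReal (p z) * F z) ^ s * (ENNReal.ofReal (p z) * G z) ^ t := by
        rw [ENNReal.mul_rpow_of_nonneg _ _ hs.le, hGz, mul_one]; ring

/-- The arithmetic–geometric mean inequality turns the multiplicative bound into an additive one,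
in the form of a difference quotient of `X` over `m` in the parameter `t`. -/
theorem mul_sub_le_of_rpow_mul_rpow_le {m X P Q t : ℝ} (hm : 0 ≤ m) (hP : 0 ≤ P) (hX : 0 ≤ X)
    (hQ : 0 ≤ Q) (hQP : Q ≤ P) (ht : 0 < t) (ht₁ : t < 1)
    (h : m ^ (1 - t) * P ^ t ≤ X ^ (1 - t) * Q ^ t) :
    m * (P - Q) ≤ P * ((X - m) / t) := by
  rcases hm.eq_or_lt with rfl | hm
  · rw [zero_mul, sub_zero]; positivity
  rcases hP.eq_or_lt with rfl | hP
  · have : Q = 0 := le_antisymm hQP hQ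
    simp [this]
  have hmP : 0 < m ^ (1 - t) * P ^ t := by positivity
  have h1 : 1 ≤ (X / m) ^ (1 - t) * (Q / P) ^ t := by
    rw [Real.div_rpow hX hm.le, Real.div_rpow hQ hP.le, div_mul_div_comm, one_le_div hmP]
    exact h
  have h2 := h1.trans (Real.geom_mean_le_arith_mean2_weighted (by linarith) ht.le
    (div_nonneg hX hm.le) (div_nonneg hQ hP.le) (by ring))
  have hq : Q / P ≤ 1 := (div_le_one hP).2 hQP
  have hx : 1 ≤ X / m := by
    by_contra! hlt
    nlinarith [mul_pos (sub_pos.2 ht₁) (sub_pos.2 hlt), mul_nonneg ht.le (sub_nonneg.2 hq)]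
  have h3 : t * (1 - Q / P) ≤ X / m - 1 := by
    nlinarith [mul_nonneg ht.le (sub_nonneg.2 hx)]
  rw [← mul_div_assoc, le_div_iff₀ ht]
  have h4 : m * P * (t * (1 - Q / P)) ≤ m * P * (X / m - 1) := by gcongr
  have e1 : m * P * (t * (1 - Q / P)) = m * (P - Q) * t := by field_simp
  have e2 : m * P * (X / m - 1) = P * (X - m) := by field_simp
  linarith

/-- The real-valued, additive form of `lintegral_rpow_mul_measure_univ_le`. -/
theorem integral_posPart_mul_measureReal_le {S : Set (EuclideanSpace ℝ (Fin d))}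
    (hS : MeasurableSet S) (hSc : Convex ℝ S) {p : EuclideanSpace ℝ (Fin d) → ℝ}
    (hpm : Measurable p) (hp₀ : ∀ x ∈ S, 0 ≤ p x) (hp : LogConcaveOn S p)
    {μ : Measure (EuclideanSpace ℝ (Fin d))} [IsFiniteMeasure μ]
    (hμ : μ = (volume.restrict S).withDensity fun x => ENNReal.ofReal (p x))
    {t : ℝ} (ht : 0 < t) (ht₁ : t < 1)
    {f F : EuclideanSpace ℝ (Fin d) → ℝ} (hf : Measurable f) (hF : Measurable F)
    (hfi : Integrable f μ) (hFi : Integrable F μ)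
    (hfF : ∀ x ∈ S, ∀ y ∈ S, f x ≤ F ((1 - t) • x + t • y)) :
    (∫ x, (f x)⁺ ∂μ) * μ.real {x | F x ≤ 0} ≤
      μ.real univ * ((∫ x, (F x)⁺ ∂μ - ∫ x, (f x)⁺ ∂μ) / t) := by
  have key := lintegral_rpow_mul_measure_univ_le hS hSc hpm hp₀ hp hμ (sub_pos.2 ht₁) ht
    (sub_add_cancel 1 t) hf.ennreal_ofReal hF.ennreal_ofReal
    fun x hx y hy => ENNReal.ofReal_le_ofReal (hfF x hx y hy)
  have hint : ∀ k : EuclideanSpace ℝ (Fin d) → ℝ, Integrable k μ →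
      ∫⁻ x, ENNReal.ofReal (k x) ∂μ = ENNReal.ofReal (∫ x, (k x)⁺ ∂μ) := by
    intro k hk
    rw [ofReal_integral_eq_lintegral_ofReal hk.real_posPart
      (Eventually.of_forall fun x => posPart_nonneg _)]
    refine lintegral_congr fun x => ?_
    rcases le_total 0 (k x) with h | h
    · rw [posPart_of_nonneg h]
    · rw [posPart_of_nonpos h, ENNReal.ofReal_of_nonpos h, ENNReal.ofReal_zero]
  have hset : {x | ENNReal.ofReal (F x) ≠ 0} = {x | F x ≤ 0}ᶜ := by ext x; simp
  have hm0 : 0 ≤ ∫ x, (f x)⁺ ∂μ := integral_nonneg fun x => posPart_nonneg _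
  have hX0 : 0 ≤ ∫ x, (F x)⁺ ∂μ := integral_nonneg fun x => posPart_nonneg _
  rw [hint f hfi, hint F hFi, hset, ← ofReal_measureReal, ← ofReal_measureReal,
    ENNReal.ofReal_rpow_of_nonneg hm0 (by linarith), ENNReal.ofReal_rpow_of_nonneg hX0 (by linarith),
    ENNReal.ofReal_rpow_of_nonneg measureReal_nonneg ht.le,
    ENNReal.ofReal_rpow_of_nonneg measureReal_nonneg ht.le, ← ENNReal.ofReal_mul (by positivity),
    ← ENNReal.ofReal_mul (by positivity), ENNReal.ofReal_le_ofReal_iff (by positivity)] at key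
  have := mul_sub_le_of_rpow_mul_rpow_le hm0 measureReal_nonneg hX0 measureReal_nonneg
    (measureReal_mono (subset_univ _)) ht ht₁ key
  rwa [measureReal_compl (measurableSet_le hF measurable_const), sub_sub_cancel] at this

/-- A first-order Taylor estimate with a radius independent of the point. -/
theorem exists_forall_dist_lt_le_add_mul_norm_fderiv {w : EuclideanSpace ℝ (Fin d) → ℝ} (hw : Differentiable ℝ w)
    (hw' : UniformContinuous (fderiv ℝ w)) {η : ℝ} (hη : 0 < η) :
    ∃ δ > 0, ∀ x z, dist x z < δ → w x ≤ w z + dist x z * (‖fderiv ℝ w z‖ + η) := by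
  obtain ⟨δ, hδ, h⟩ := Metric.uniformContinuous_iff.1 hw' η hη
  refine ⟨δ, hδ, fun x z hxz => ?_⟩
  have h1 := (convex_ball z δ).norm_image_sub_le_of_norm_fderiv_le' (𝕜 := ℝ) (f := w)
    (φ := fderiv ℝ w z) (C := η) (fun y _ => hw y)
    (fun y hy => by rw [← dist_eq_norm]; exact (h hy).le) (Metric.mem_ball_self hδ) hxz
  have h2 := (le_abs_self _).trans ((fderiv ℝ w z).le_opNorm (x - z))
  have h3 := (le_abs_self _).trans h1
  rw [dist_eq_norm]
  nlinarith

/-- The infinitesimal form of `integral_posPart_mul_measureReal_le`: with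
`F = w + t * D * (‖∇w‖ + η)`, which dominates `w` at distance at most `t * D`, the difference
quotient of the integrals of the positive parts tends to an integral over `{w > 0}` as `t → 0`. The
level set `{w = 0}` has to be null for the limit to exist almost everywhere. -/
theorem integral_posPart_mul_measureReal_neg_le {S : Set (EuclideanSpace ℝ (Fin d))}
    (hS : MeasurableSet S) (hSc : Convex ℝ S) {p : EuclideanSpace ℝ (Fin d) → ℝ}
    (hpm : Measurable p) (hp₀ : ∀ x ∈ S, 0 ≤ p x) (hp : LogConcaveOn S p)
    {μ : Measure (EuclideanSpace ℝ (Fin d))} [IsFiniteMeasure μ]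
    (hμ : μ = (volume.restrict S).withDensity fun x => ENNReal.ofReal (p x))
    {D : ℝ} (hD : 0 < D) (hSD : ∀ x ∈ S, ∀ y ∈ S, dist x y ≤ D)
    {w : EuclideanSpace ℝ (Fin d) → ℝ} (hw : Differentiable ℝ w)
    (hw' : UniformContinuous (fderiv ℝ w)) (hwi : Integrable w μ)
    (hwi' : Integrable (fderiv ℝ w) μ) (hw₀ : μ {x | w x = 0} = 0) :
    (∫ x, (w x)⁺ ∂μ) * μ.real {x | w x < 0} ≤
      μ.real univ * (D * ∫ x in {x | 0 < w x}, ‖fderiv ℝ w x‖ ∂μ) := by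
  have hwm : Measurable w := hw.continuous.measurable
  have hne : ∀ᵐ x ∂μ, w x ≠ 0 := by rw [ae_iff]; simpa using hw₀
  have hpos : MeasurableSet {x | 0 < w x} := measurableSet_lt measurable_const hwm
  have hneg : MeasurableSet {x | w x < 0} := measurableSet_lt hwm measurable_const
  -- The slope `‖∇w‖` is first enlarged by `η`, which absorbs the first-order Taylor remainder.
  have main : ∀ η > 0, (∫ x, (w x)⁺ ∂μ) * μ.real {x | w x < 0} ≤
      μ.real univ * ∫ x in {x | 0 < w x}, D * (‖fderiv ℝ w x‖ + η) ∂μ := by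
    intro η hη
    obtain ⟨δ, hδ, hδw⟩ := exists_forall_dist_lt_le_add_mul_norm_fderiv hw hw' hη
    set κ : EuclideanSpace ℝ (Fin d) → ℝ := fun x => D * (‖fderiv ℝ w x‖ + η) with hκ
    have hκ0 : ∀ x, 0 ≤ κ x := fun x => by positivity
    have hκi : Integrable κ μ := (hwi'.norm.add (integrable_const η)).const_mul D
    have hκm : Measurable κ := by
      have := hw'.continuous
      exact (by fun_prop : Continuous κ).measurable
    have hstep : ∀ᶠ t in 𝓝[>] (0 : ℝ),
        (∫ x, (w x)⁺ ∂μ) * ∫ x, {x | w x + t * κ x ≤ 0}.indicator (fun _ => (1 : ℝ)) x ∂μ ≤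
          μ.real univ * ∫ x, ((w x + t * κ x)⁺ - (w x)⁺) / t ∂μ := by
      have hsmall : ∀ᶠ t in 𝓝[>] (0 : ℝ), t < min 1 (δ / D) :=
        nhdsWithin_le_nhds (Iio_mem_nhds (lt_min one_pos (div_pos hδ hD)))
      filter_upwards [hsmall, self_mem_nhdsWithin] with t htt ht
      have ht : 0 < t := ht
      have ht1 : t < 1 := htt.trans_le (min_le_left _ _)
      have htD : t * D < δ := (lt_div_iff₀ hD).1 (htt.trans_le (min_le_right _ _))
      have hFm : Measurable fun x => w x + t * κ x := hwm.add (hκm.const_mul t)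
      have hFi : Integrable (fun x => w x + t * κ x) μ := hwi.add (hκi.const_mul t)
      have h := integral_posPart_mul_measureReal_le hS hSc hpm hp₀ hp hμ ht ht1 hwm hFm hwi hFi
        (fun x hx y hy => by
          set z := (1 - t) • x + t • y
          have hxz : dist x z ≤ t * D := by
            have : x - z = t • (x - y) := by simp only [z]; module
            rw [dist_eq_norm, this, norm_smul, Real.norm_of_nonneg ht.le, ← dist_eq_norm]
            gcongr
            exact hSD x hx y hy
          refine (hδw x z (hxz.trans_lt htD)).trans ?_
          simp only [hκ]
          rw [← mul_assoc]
          gcongr)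
      rw [integral_div, integral_sub hFi.real_posPart hwi.real_posPart,
        integral_indicator_const _ (measurableSet_le hFm measurable_const), smul_eq_mul, mul_one]
      exact h
    have hlim1 : Tendsto (fun t : ℝ => ∫ x, {x | w x + t * κ x ≤ 0}.indicator
        (fun _ => (1 : ℝ)) x ∂μ) (𝓝[>] 0) (𝓝 (μ.real {x | w x < 0})) := by
      have hrw : μ.real {x | w x < 0} = ∫ x, {x | w x < 0}.indicator (fun _ => (1 : ℝ)) x ∂μ := by
        rw [integral_indicator_const _ hneg, smul_eq_mul, mul_one]
      rw [hrw]
      refine tendsto_integral_filter_of_dominated_convergence (fun _ => 1)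
        (Eventually.of_forall fun t => (measurable_const.indicator
          (measurableSet_le (hwm.add (hκm.const_mul t)) measurable_const)).aestronglyMeasurable)
        (Eventually.of_forall fun t => Eventually.of_forall fun x => ?_) (integrable_const 1) ?_
      · exact (norm_indicator_le_norm_self _ _).trans (by simp)
      · filter_upwards [hne] with x hx
        have hcont : Tendsto (fun t : ℝ => w x + t * κ x) (𝓝[>] 0) (𝓝 (w x)) := by
          have : Continuous fun t : ℝ => w x + t * κ x := by fun_prop
          simpa using (this.tendsto 0).mono_left nhdsWithin_le_nhds
        refine tendsto_const_nhds.congr' ?_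
        rcases lt_or_gt_of_ne hx with hx | hx
        · filter_upwards [hcont.eventually (Iio_mem_nhds hx)] with t ht
          have ht : w x + t * κ x < 0 := ht
          simp [hx, ht.le]
        · filter_upwards [hcont.eventually (Ioi_mem_nhds hx)] with t ht
          have ht : 0 < w x + t * κ x := ht
          simp [hx.le, ht]
    have hlim2 : Tendsto (fun t : ℝ => ∫ x, ((w x + t * κ x)⁺ - (w x)⁺) / t ∂μ) (𝓝[>] 0)
        (𝓝 (∫ x in {x | 0 < w x}, κ x ∂μ)) := by
      rw [← integral_indicator hpos]
      refine tendsto_integral_filter_of_dominated_convergence κ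
        (Eventually.of_forall fun t => ?_) ?_ hκi ?_
      · have h1 : Measurable fun x => (w x + t * κ x)⁺ :=
          (hwm.add (hκm.const_mul t)).sup measurable_const
        have h2 : Measurable fun x => (w x)⁺ := hwm.sup measurable_const
        exact ((h1.sub h2).div_const t).aestronglyMeasurable
      · filter_upwards [self_mem_nhdsWithin] with t ht
        have ht : 0 < t := ht
        refine Eventually.of_forall fun x => ?_
        rw [norm_div, Real.norm_of_nonneg ht.le, div_le_iff₀ ht, Real.norm_eq_abs]
        refine (abs_max_sub_max_le_abs _ _ 0).trans ?_
        rw [add_sub_cancel_left, abs_of_nonneg (mul_nonneg ht.le (hκ0 x)), mul_comm]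
      · filter_upwards [hne] with x hx
        have hcont : Tendsto (fun t : ℝ => w x + t * κ x) (𝓝[>] 0) (𝓝 (w x)) := by
          have : Continuous fun t : ℝ => w x + t * κ x := by fun_prop
          simpa using (this.tendsto 0).mono_left nhdsWithin_le_nhds
        refine tendsto_const_nhds.congr' ?_
        rcases lt_or_gt_of_ne hx with hx | hx
        · filter_upwards [hcont.eventually (Iio_mem_nhds hx)] with t ht
          have ht : w x + t * κ x < 0 := ht
          rw [posPart_of_nonpos ht.le, posPart_of_nonpos hx.le]
          simp [hx.le]
        · filter_upwards [hcont.eventually (Ioi_mem_nhds hx), self_mem_nhdsWithin] with t ht ht0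
          have ht : 0 < w x + t * κ x := ht
          have ht0 : 0 < t := ht0
          rw [posPart_of_nonneg ht.le, posPart_of_nonneg hx.le, indicator_of_mem (by exact hx)]
          field_simp
          ring
    exact le_of_tendsto_of_tendsto (hlim1.const_mul _) (hlim2.const_mul _) hstep
  have hi : IntegrableOn (fun x => ‖fderiv ℝ w x‖) {x | 0 < w x} μ := hwi'.norm.integrableOn
  set C := μ.real univ * (D * μ.real {x | 0 < w x}) with hC
  have hC0 : 0 ≤ C := by positivity
  refine le_of_forall_pos_le_add fun ε hε => ?_
  refine (main (ε / (C + 1)) (by positivity)).trans ?_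
  rw [integral_const_mul, integral_add hi (integrable_const _), setIntegral_const, smul_eq_mul]
  have : C * (ε / (C + 1)) ≤ ε := by
    rw [← mul_div_assoc, div_le_iff₀ (by positivity)]
    nlinarith
  calc _ = μ.real univ * (D * ∫ x in {x | 0 < w x}, ‖fderiv ℝ w x‖ ∂μ) + C * (ε / (C + 1)) := by
        rw [hC]; ring
    _ ≤ _ := by linarith

/-- The smooth Poincaré inequality when the zero set is null: the infinitesimal inequalities for `w`
and `-w` involve the gradient on the disjoint sets `{w > 0}` and `{w < 0}`, and their sum bounds the
smaller one of the integrals of `w⁺` and `w⁻` by `D * ∫ ‖∇w‖`. -/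
theorem integral_abs_le_of_measure_eq_zero {S : Set (EuclideanSpace ℝ (Fin d))}
    (hS : MeasurableSet S) (hSc : Convex ℝ S) {p : EuclideanSpace ℝ (Fin d) → ℝ}
    (hpm : Measurable p) (hp₀ : ∀ x ∈ S, 0 ≤ p x) (hp : LogConcaveOn S p)
    {μ : Measure (EuclideanSpace ℝ (Fin d))} [IsFiniteMeasure μ]
    (hμ : μ = (volume.restrict S).withDensity fun x => ENNReal.ofReal (p x))
    {D : ℝ} (hD : 0 < D) (hSD : ∀ x ∈ S, ∀ y ∈ S, dist x y ≤ D)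
    {w : EuclideanSpace ℝ (Fin d) → ℝ} (hw : Differentiable ℝ w)
    (hw' : UniformContinuous (fderiv ℝ w)) (hwi : Integrable w μ)
    (hwi' : Integrable (fderiv ℝ w) μ) (hw₀ : μ {x | w x = 0} = 0) :
    ∫ x, |w x| ∂μ ≤ |∫ x, w x ∂μ| + 2 * D * ∫ x, ‖fderiv ℝ w x‖ ∂μ := by
  have hwm : Measurable w := hw.continuous.measurable
  have hpos : MeasurableSet {x | 0 < w x} := measurableSet_lt measurable_const hwm
  have hneg : MeasurableSet {x | w x < 0} := measurableSet_lt hwm measurable_const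
  have hfd : fderiv ℝ (fun x => -w x) = fun x => -fderiv ℝ w x := by
    funext x; exact fderiv_fun_neg
  have h1 := integral_posPart_mul_measureReal_neg_le hS hSc hpm hp₀ hp hμ hD hSD hw hw' hwi hwi' hw₀
  have h2 := integral_posPart_mul_measureReal_neg_le hS hSc hpm hp₀ hp hμ hD hSD (w := fun x => -w x)
    hw.neg (by rw [hfd]; exact hw'.neg) hwi.neg (by rw [hfd]; exact hwi'.neg) (by simpa using hw₀)
  simp only [hfd, norm_neg, neg_lt_zero, Left.neg_pos_iff, posPart_neg] at h2
  have hdisj : Disjoint {x | 0 < w x} {x | w x < 0} :=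
    disjoint_left.2 fun x (hx : 0 < w x) (hx' : w x < 0) => lt_asymm hx hx'
  have hcompl : ({x | 0 < w x} ∪ {x | w x < 0})ᶜ = {x | w x = 0} := by
    ext x; simp only [mem_compl_iff, mem_union, mem_ofPred_eq, not_or, not_lt]
    exact ⟨fun h => le_antisymm h.1 h.2, fun h => ⟨h.le, h.ge⟩⟩
  have hmass : μ.real {x | 0 < w x} + μ.real {x | w x < 0} = μ.real univ := by
    rw [← measureReal_union hdisj hneg, ← measureReal_add_measureReal_compl (hpos.union hneg),
      hcompl, measureReal_def μ {x | w x = 0}, hw₀]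
    simp
  have hgrad : ∫ x in {x | 0 < w x}, ‖fderiv ℝ w x‖ ∂μ + ∫ x in {x | w x < 0}, ‖fderiv ℝ w x‖ ∂μ ≤
      ∫ x, ‖fderiv ℝ w x‖ ∂μ := by
    rw [← setIntegral_union hdisj hneg hwi'.norm.integrableOn hwi'.norm.integrableOn]
    exact setIntegral_le_integral hwi'.norm (Eventually.of_forall fun x => norm_nonneg _)
  set G := ∫ x, ‖fderiv ℝ w x‖ ∂μ
  set a := ∫ x, (w x)⁺ ∂μ
  set b := ∫ x, (w x)⁻ ∂μ
  have habs : ∫ x, |w x| ∂μ = a + b := by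
    rw [← integral_add hwi.real_posPart hwi.real_negPart]
    exact integral_congr_ae (Eventually.of_forall fun x => (posPart_add_negPart (w x)).symm)
  have hint : ∫ x, w x ∂μ = a - b := by
    rw [← integral_sub hwi.real_posPart hwi.real_negPart]
    exact integral_congr_ae (Eventually.of_forall fun x => (posPart_sub_negPart (w x)).symm)
  set P := μ.real univ with hP
  rcases (measureReal_nonneg : 0 ≤ P).eq_or_lt with hP0 | hP0
  · have : μ = 0 := by
      rw [← Measure.measure_univ_eq_zero]
      exact (measureReal_eq_zero_iff (measure_ne_top _ _)).1 hP0.symm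
    simp [G, this]
  have hmin : min a b ≤ D * G := by
    have e1 := mul_le_mul_of_nonneg_right (min_le_left a b)
      (measureReal_nonneg (μ := μ) (s := {x | w x < 0}))
    have e2 := mul_le_mul_of_nonneg_right (min_le_right a b)
      (measureReal_nonneg (μ := μ) (s := {x | 0 < w x}))
    have e3 : min a b * P = min a b * μ.real {x | w x < 0} + min a b * μ.real {x | 0 < w x} := by
      rw [← hmass]; ring
    have e4 := mul_le_mul_of_nonneg_left hgrad (mul_nonneg (show 0 ≤ P from hP0.le) hD.le)
    have e5 : min a b * P ≤ D * G * P := by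
      rw [e3]
      linarith
    exact le_of_mul_le_mul_right e5 hP0
  rw [habs, hint]
  rcases le_total a b with hab | hab
  · rw [min_eq_left hab] at hmin
    linarith [neg_abs_le (a - b)]
  · rw [min_eq_right hab] at hmin
    linarith [le_abs_self (a - b)]

/-- The Poincaré inequality for smooth functions, in a form that does not require mean zero and is
therefore stable under approximation. A small constant is subtracted from `u` so that the zero set
becomes null. -/
theorem integral_abs_le_of_uniformContinuous_fderiv {S : Set (EuclideanSpace ℝ (Fin d))}
    (hS : MeasurableSet S) (hSc : Convex ℝ S) {p : EuclideanSpace ℝ (Fin d) → ℝ}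
    (hpm : Measurable p) (hp₀ : ∀ x ∈ S, 0 ≤ p x) (hp : LogConcaveOn S p)
    {μ : Measure (EuclideanSpace ℝ (Fin d))} [IsFiniteMeasure μ]
    (hμ : μ = (volume.restrict S).withDensity fun x => ENNReal.ofReal (p x))
    {D : ℝ} (hD : 0 < D) (hSD : ∀ x ∈ S, ∀ y ∈ S, dist x y ≤ D)
    {u : EuclideanSpace ℝ (Fin d) → ℝ} (hu : Differentiable ℝ u)
    (hu' : UniformContinuous (fderiv ℝ u)) (hui : Integrable u μ)
    (hui' : Integrable (fderiv ℝ u) μ) :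
    ∫ x, |u x| ∂μ ≤ |∫ x, u x ∂μ| + 2 * D * ∫ x, ‖fderiv ℝ u x‖ ∂μ := by
  set P := μ.real univ with hP
  have hP0 : 0 ≤ P := measureReal_nonneg
  refine le_of_forall_pos_le_add fun ε hε => ?_
  -- All but countably many level sets of `u` are null.
  obtain ⟨c, hc, hcε⟩ := ((Measure.countable_meas_level_set_pos (μ := μ)
    hu.continuous.measurable).dense_compl ℝ).exists_dist_lt 0
    (show 0 < ε / (2 * P + 1) by positivity)
  have hc0 : μ {x | u x - c = 0} = 0 := by
    simpa [sub_eq_zero] using hc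
  rw [dist_zero_left, Real.norm_eq_abs, lt_div_iff₀ (by positivity)] at hcε
  have hfd : fderiv ℝ (fun x => u x - c) = fderiv ℝ u := by
    funext x; exact fderiv_sub_const c
  have h := integral_abs_le_of_measure_eq_zero hS hSc hpm hp₀ hp hμ hD hSD
    (hu.sub_const c) (by rwa [hfd]) (hui.sub (integrable_const c)) (by rwa [hfd]) hc0
  rw [hfd, integral_sub hui (integrable_const c), integral_const, smul_eq_mul, ← hP] at h
  have h1 : ∫ x, |u x| ∂μ ≤ ∫ x, |u x - c| ∂μ + P * |c| := by
    have : ∫ x, |c| ∂μ = P * |c| := by rw [integral_const, smul_eq_mul]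
    have hi : Integrable (fun x => |u x - c|) μ := (hui.sub (integrable_const c)).abs
    rw [← this, ← integral_add hi (integrable_const _)]
    refine integral_mono hui.abs (hi.add (integrable_const _)) fun x => ?_
    have := abs_add_le (u x - c) c
    rwa [sub_add_cancel] at this
  have h2 : |∫ x, u x ∂μ - P * c| ≤ |∫ x, u x ∂μ| + P * |c| := by
    refine (abs_sub _ _).trans ?_
    rw [abs_mul, abs_of_nonneg hP0]
  nlinarith [abs_nonneg c]

/-! ### Mollification -/

/-- Convolution with an even kernel is self-adjoint for the `L²` pairing. -/
theorem integral_convolution_mul_comm {ρ v W : EuclideanSpace ℝ (Fin d) → ℝ}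
    (hρ : Integrable ρ) (hρ_even : ∀ x, ρ (-x) = ρ x) (hv : Integrable v)
    (hWm : Measurable W) {M : ℝ} (hWM : ∀ x, ‖W x‖ ≤ M) :
    ∫ x, (ρ ⋆[ContinuousLinearMap.lsmul ℝ ℝ, volume] v) x * W x =
      ∫ x, v x * (ρ ⋆[ContinuousLinearMap.lsmul ℝ ℝ, volume] W) x := by
  have hint : Integrable (fun q : EuclideanSpace ℝ (Fin d) × EuclideanSpace ℝ (Fin d) =>
      v q.2 * ρ (q.1 - q.2) * W q.1) (volume.prod volume) :=
    (hv.convolution_integrand (ContinuousLinearMap.lsmul ℝ ℝ) hρ).mul_bdd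
      (hWm.comp measurable_fst).aestronglyMeasurable (Eventually.of_forall fun q => hWM q.1)
  calc ∫ x, (ρ ⋆[ContinuousLinearMap.lsmul ℝ ℝ, volume] v) x * W x
      = ∫ x, ∫ y, v y * ρ (x - y) * W x := by
        refine integral_congr_ae (Eventually.of_forall fun x => ?_)
        simp only
        rw [convolution_eq_swap, ← integral_mul_const]
        refine integral_congr_ae (Eventually.of_forall fun y => ?_)
        simp [mul_comm (ρ (x - y))]
    _ = ∫ y, ∫ x, v y * ρ (x - y) * W x := integral_integral_swap hint
    _ = ∫ x, v x * (ρ ⋆[ContinuousLinearMap.lsmul ℝ ℝ, volume] W) x := by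
        refine integral_congr_ae (Eventually.of_forall fun y => ?_)
        simp only
        rw [convolution_eq_swap, ← integral_const_mul]
        refine integral_congr_ae (Eventually.of_forall fun x => ?_)
        simp only [ContinuousLinearMap.lsmul_apply, smul_eq_mul]
        rw [← hρ_even (y - x), neg_sub, mul_assoc]

theorem ContDiffBump.norm_convolution_normed_le (φ : ContDiffBump (0 : EuclideanSpace ℝ (Fin d)))
    {W : EuclideanSpace ℝ (Fin d) → ℝ} {M : ℝ} (hWM : ∀ x, ‖W x‖ ≤ M)
    (x : EuclideanSpace ℝ (Fin d)) :
    ‖(φ.normed volume ⋆[ContinuousLinearMap.lsmul ℝ ℝ, volume] W) x‖ ≤ M := by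
  rw [convolution_def]
  calc _ ≤ ∫ t, φ.normed volume t * M :=
        norm_integral_le_of_norm_le (φ.integrable_normed.mul_const M)
          (Eventually.of_forall fun t => by
            simp only [ContinuousLinearMap.lsmul_apply, smul_eq_mul, norm_mul,
              Real.norm_of_nonneg (φ.nonneg_normed t)]
            exact mul_le_mul_of_nonneg_left (hWM _) (φ.nonneg_normed t))
    _ = M := by rw [integral_mul_const, φ.integral_normed, one_mul]

/-- Mollification converges in the weak sense against bounded functions. By self-adjointness only
the bounded function has to be mollified, and dominated convergence applies to it. -/
theorem tendsto_integral_convolution_mul {φ : ℕ → ContDiffBump (0 : EuclideanSpace ℝ (Fin d))}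
    {K : ℝ} (hφ : Tendsto (fun n => (φ n).rOut) atTop (𝓝 0))
    (hφK : ∀ᶠ n in atTop, (φ n).rOut ≤ K * (φ n).rIn) {v W : EuclideanSpace ℝ (Fin d) → ℝ}
    (hv : Integrable v) (hWm : Measurable W) (hWi : Integrable W) {M : ℝ}
    (hWM : ∀ x, ‖W x‖ ≤ M) :
    Tendsto (fun n => ∫ x, ((φ n).normed volume ⋆[ContinuousLinearMap.lsmul ℝ ℝ, volume] v) x * W x)
      atTop (𝓝 (∫ x, v x * W x)) := by
  have hrw : ∀ n, ∫ x, ((φ n).normed volume ⋆[ContinuousLinearMap.lsmul ℝ ℝ, volume] v) x * W x =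
      ∫ x, v x * ((φ n).normed volume ⋆[ContinuousLinearMap.lsmul ℝ ℝ, volume] W) x := fun n =>
    integral_convolution_mul_comm (φ n).integrable_normed (φ n).normed_neg hv hWm hWM
  simp only [hrw]
  refine tendsto_integral_of_dominated_convergence (fun x => ‖v x‖ * M) (fun n => ?_)
    (hv.norm.mul_const M) (fun n => Eventually.of_forall fun x => ?_) ?_
  · have hc : ContDiff ℝ (0 : ℕ∞)
        ((φ n).normed volume ⋆[ContinuousLinearMap.lsmul ℝ ℝ, volume] W) :=
      (φ n).hasCompactSupport_normed.contDiff_convolution_left _ (φ n).contDiff_normed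
        hWi.locallyIntegrable
    exact hv.aestronglyMeasurable.mul hc.continuous.aestronglyMeasurable
  · rw [norm_mul]
    exact mul_le_mul_of_nonneg_left ((φ n).norm_convolution_normed_le hWM x) (norm_nonneg _)
  · filter_upwards [ContDiffBump.ae_convolution_tendsto_right_of_locallyIntegrable hφ hφK
      hWi.locallyIntegrable] with x hx
    exact hx.const_mul _

/-- A form of Fatou's lemma for Bochner integrals of norms. -/
theorem integral_norm_le_of_tendsto {α : Type*} [MeasurableSpace α] {μ : Measure α}
    {f : ℕ → α → ℝ} {g : α → ℝ} (hf : ∀ n, Integrable (f n) μ) (hg : Integrable g μ)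
    (hfg : ∀ᵐ x ∂μ, Tendsto (fun n => f n x) atTop (𝓝 (g x))) {c : ℕ → ℝ} {C : ℝ}
    (hc : ∀ n, ∫ x, ‖f n x‖ ∂μ ≤ c n) (hcC : Tendsto c atTop (𝓝 C)) :
    ∫ x, ‖g x‖ ∂μ ≤ C := by
  have hC : 0 ≤ C := ge_of_tendsto' hcC fun n => (integral_nonneg fun _ => norm_nonneg _).trans (hc n)
  rw [← ENNReal.ofReal_le_ofReal_iff hC, ofReal_integral_norm_eq_lintegral_enorm hg]
  calc ∫⁻ x, ‖g x‖ₑ ∂μ = ∫⁻ x, liminf (fun n => ‖f n x‖ₑ) atTop ∂μ := by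
        refine lintegral_congr_ae ?_
        filter_upwards [hfg] with x hx using hx.enorm.liminf_eq.symm
    _ ≤ liminf (fun n => ∫⁻ x, ‖f n x‖ₑ ∂μ) atTop :=
        lintegral_liminf_le' fun n => (hf n).aestronglyMeasurable.enorm
    _ ≤ liminf (fun n => ENNReal.ofReal (c n)) atTop := by
        refine liminf_le_liminf (Eventually.of_forall fun n => ?_)
        rw [← ofReal_integral_norm_eq_lintegral_enorm (hf n)]
        exact ENNReal.ofReal_le_ofReal (hc n)
    _ = ENNReal.ofReal C := (ENNReal.tendsto_ofReal hcC).liminf_eq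

/-- At distance more than the mollification radius from the boundary, the gradient of the
mollification is the mollification of the weak gradient, so that its norm is at most the
mollification of the norm. -/
theorem norm_fderiv_convolution_normed_le {Ω : Set (EuclideanSpace ℝ (Fin d))}
    (hΩ : IsOpen Ω) {u : EuclideanSpace ℝ (Fin d) → ℝ}
    {g : EuclideanSpace ℝ (Fin d) → EuclideanSpace ℝ (Fin d)} (hug : HasWeakGradientOn Ω u g)
    (hu : IntegrableOn u Ω) (hg : IntegrableOn g Ω)
    (φ : ContDiffBump (0 : EuclideanSpace ℝ (Fin d))) {x : EuclideanSpace ℝ (Fin d)}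
    (hx : Metric.closedBall x φ.rOut ⊆ Ω) :
    ‖fderiv ℝ (φ.normed volume ⋆[ContinuousLinearMap.lsmul ℝ ℝ, volume] Ω.indicator u) x‖ ≤
      (φ.normed volume ⋆[ContinuousLinearMap.lsmul ℝ ℝ, volume]
        fun y => ‖Ω.indicator g y‖) x := by
  set ρ := φ.normed volume with hρ
  have hρs : ContDiff ℝ ∞ ρ := φ.contDiff_normed
  have hρ1 : ContDiff ℝ 1 ρ := φ.contDiff_normed
  have hρc : HasCompactSupport ρ := φ.hasCompactSupport_normed
  have hui : Integrable (Ω.indicator u) := hu.integrable_indicator hΩ.measurableSet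
  have hgi : Integrable (Ω.indicator g) := hg.integrable_indicator hΩ.measurableSet
  -- The test function `y ↦ ρ (x - y)`.
  set ψ : EuclideanSpace ℝ (Fin d) → ℝ := fun y => ρ (x - y) with hψ
  have hψs : ContDiff ℝ ∞ ψ := hρs.comp (contDiff_const.sub contDiff_id)
  have hψ0 : ∀ y ∉ Metric.closedBall x φ.rOut, ψ y = 0 := by
    intro y hy
    have : x - y ∉ Function.support ρ := by
      rw [hρ, φ.support_normed_eq, mem_ball_zero_iff]
      rw [Metric.mem_closedBall, dist_comm, dist_eq_norm] at hy
      linarith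
    simpa [Function.mem_support] using this
  have hψc : HasCompactSupport ψ := HasCompactSupport.intro (isCompact_closedBall x φ.rOut) hψ0
  have hψΩ : tsupport ψ ⊆ Ω :=
    (closure_minimal (Function.support_subset_iff'.2 hψ0)
      Metric.isClosed_closedBall).trans hx
  have hψd : ∀ y v, fderiv ℝ ψ y v = -fderiv ℝ ρ (x - y) v := by
    intro y v
    have h := ((hρ1.differentiable one_ne_zero) (x - y)).hasFDerivAt.comp y
      ((hasFDerivAt_const x y).sub (hasFDerivAt_id y))
    rw [show ψ = ρ ∘ (fun y => x - y) from rfl, h.fderiv]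
    simp
  obtain ⟨B, hB⟩ := hψs.continuous.bounded_above_of_compact_support hψc
  have hGi : Integrable fun y => ψ y • Ω.indicator g y :=
    hgi.bdd_smul B hψs.continuous.aestronglyMeasurable (Eventually.of_forall hB)
  set G : EuclideanSpace ℝ (Fin d) := ∫ y, ψ y • Ω.indicator g y with hG
  set m := ρ ⋆[ContinuousLinearMap.lsmul ℝ ℝ, volume] Ω.indicator u with hm
  set L : ℝ →L[ℝ] ℝ →L[ℝ] ℝ := (ContinuousLinearMap.lsmul ℝ ℝ).flip with hL
  have hmL : m = Ω.indicator u ⋆[L, volume] ρ := (convolution_flip _).symm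
  have hmd := hρc.hasFDerivAt_convolution_right L hui.locallyIntegrable hρ1 x
  rw [← hmL] at hmd
  have hcoord : ∀ i : Fin d, fderiv ℝ m x (EuclideanSpace.single i 1) = G i := by
    intro i
    rw [hmd.fderiv, convolution_precompR_apply _ hui.locallyIntegrable (hρc.fderiv (𝕜 := ℝ))
      (hρ1.continuous_fderiv one_ne_zero)]
    have hGi' : G i = ∫ y, (ψ y • Ω.indicator g y) i :=
      ((EuclideanSpace.proj (𝕜 := ℝ) i).integral_comp_comm hGi).symm
    have h1 := hug.integral_eq ψ hψs hψc hψΩ i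
    rw [← neg_eq_iff_eq_neg, ← integral_neg] at h1
    rw [← integral_indicator hΩ.measurableSet, ← integral_indicator hΩ.measurableSet] at h1
    rw [hGi', convolution_def]
    refine Eq.trans ?_ (h1.trans ?_)
    · refine integral_congr_ae (Eventually.of_forall fun y => ?_)
      by_cases hy : y ∈ Ω <;> simp [hy, hψd, hL, mul_comm]
    · refine integral_congr_ae (Eventually.of_forall fun y => ?_)
      by_cases hy : y ∈ Ω <;> simp [hy, mul_comm]
  have hfd : fderiv ℝ m x = innerSL ℝ G := by
    refine ContinuousLinearMap.coe_injective
      ((EuclideanSpace.basisFun (Fin d) ℝ).toBasis.ext fun i => ?_)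
    simp [hcoord, EuclideanSpace.inner_single_right]
  rw [hfd, innerSL_apply_norm, convolution_eq_swap]
  refine (norm_integral_le_integral_norm _).trans_eq (integral_congr_ae
    (Eventually.of_forall fun y => ?_))
  simp only [norm_smul, ContinuousLinearMap.lsmul_apply, smul_eq_mul, hψ]
  rw [Real.norm_of_nonneg (φ.nonneg_normed _)]

/-! ### Bounded weights and uniqueness of weak gradients -/

/-- A log-concave function on a bounded convex open set is bounded above. A point `x₀` at which it
does not vanish is a convex combination, with fixed weights, of an arbitrary point `x` and of a
point `y` near `x₀`. -/
theorem LogConcaveOn.exists_forall_le {Ω : Set (EuclideanSpace ℝ (Fin d))} (hΩ : IsOpen Ω)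
    (hΩb : Bornology.IsBounded Ω) {p : EuclideanSpace ℝ (Fin d) → ℝ}
    (hp₀ : ∀ x ∈ Ω, 0 ≤ p x) (hp : LogConcaveOn Ω p) (hpc : ContinuousOn p Ω) :
    ∃ M, 0 ≤ M ∧ ∀ x ∈ Ω, p x ≤ M := by
  by_cases hzero : ∀ x ∈ Ω, p x ≤ 0
  · exact ⟨0, le_rfl, hzero⟩
  push Not at hzero
  obtain ⟨x₀, hx₀, hpos⟩ := hzero
  have hnear : ∀ᶠ y in 𝓝 x₀, p x₀ / 2 < p y :=
    (hpc.continuousAt (hΩ.mem_nhds hx₀)).eventually (lt_mem_nhds (by linarith))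
  obtain ⟨r, hr, hball⟩ := Metric.eventually_nhds_iff_ball.1 (hnear.and (hΩ.mem_nhds hx₀))
  obtain ⟨R, hR, hΩR⟩ : ∃ R > 0, ∀ x ∈ Ω, dist x x₀ < R := by
    obtain ⟨R, hR⟩ := hΩb.subset_ball x₀
    exact ⟨R, Metric.pos_of_mem_ball (hR hx₀), fun x hx => hR hx⟩
  set ε := r / R with hε
  have hε0 : 0 < ε := div_pos hr hR
  set a := ε / (1 + ε) with ha
  set b := 1 / (1 + ε) with hb
  have ha0 : 0 < a := by positivity
  have hb0 : 0 < b := by positivity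
  have hab : a + b = 1 := by rw [ha, hb]; field_simp; ring
  have hc : 0 < (p x₀ / 2) ^ b := by positivity
  refine ⟨(p x₀ / (p x₀ / 2) ^ b) ^ (1 / a), by positivity, fun x hx => ?_⟩
  set y := x₀ - ε • (x - x₀) with hy
  have hyball : y ∈ Metric.ball x₀ r := by
    rw [Metric.mem_ball, dist_eq_norm, hy, sub_sub_cancel_left, norm_neg, norm_smul,
      Real.norm_of_nonneg hε0.le, ← dist_eq_norm]
    calc ε * dist x x₀ < ε * R := by gcongr; exact hΩR x hx
      _ = r := by rw [hε]; field_simp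
  have hcomb : a • x + b • y = x₀ := by
    have h1 : a = ε * b := by rw [ha, hb]; ring
    have h2 : b * (1 + ε) = 1 := by rw [hb]; field_simp
    have h3 : a • x + b • y = (b * (1 + ε)) • x₀ := by
      rw [hy, h1]; module
    rw [h3, h2, one_smul]
  have h := hp hx (hball y hyball).2 ha0 hb0 hab
  rw [hcomb] at h
  have h1 : p x ^ a ≤ p x₀ / (p x₀ / 2) ^ b := by
    rw [le_div_iff₀ hc]
    refine le_trans ?_ h
    have := Real.rpow_nonneg (hp₀ x hx) a
    have := (hball y hyball).1
    gcongr
  calc p x = (p x ^ a) ^ (1 / a) := by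
        rw [← Real.rpow_mul (hp₀ x hx), mul_one_div_cancel ha0.ne', Real.rpow_one]
    _ ≤ _ := Real.rpow_le_rpow (Real.rpow_nonneg (hp₀ x hx) a) h1 (by positivity)

/-- Weak gradients are unique up to null sets. -/
theorem HasWeakGradientOn.ae_eq {Ω : Set (EuclideanSpace ℝ (Fin d))} (hΩ : IsOpen Ω)
    {u : EuclideanSpace ℝ (Fin d) → ℝ}
    {g g' : EuclideanSpace ℝ (Fin d) → EuclideanSpace ℝ (Fin d)}
    (hg : HasWeakGradientOn Ω u g) (hg' : HasWeakGradientOn Ω u g') :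
    g =ᵐ[volume.restrict Ω] g' := by
  have hcoord : ∀ i : Fin d, ∀ᵐ x, x ∈ Ω → g x i - g' x i = 0 := by
    intro i
    have hloc : ∀ {h : EuclideanSpace ℝ (Fin d) → EuclideanSpace ℝ (Fin d)},
        LocallyIntegrableOn h Ω → LocallyIntegrableOn (fun x => h x i) Ω := by
      intro h hh x hx
      obtain ⟨s, hs, hsi⟩ := hh x hx
      exact ⟨s, hs, (EuclideanSpace.proj (𝕜 := ℝ) i).integrable_comp hsi⟩
    have h1 := hloc hg.locallyIntegrableOn_grad
    have h2 := hloc hg'.locallyIntegrableOn_grad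
    refine hΩ.ae_eq_zero_of_integral_contDiff_smul_eq_zero (h1.sub h2) fun φ hφ hφc hφΩ => ?_
    have hmul : ∀ {h : EuclideanSpace ℝ (Fin d) → ℝ}, LocallyIntegrableOn h Ω →
        Integrable fun x => h x * φ x := by
      intro h hh
      obtain ⟨B, hB⟩ := hφ.continuous.bounded_above_of_compact_support hφc
      have hK : IntegrableOn (fun x => h x * φ x) (tsupport φ) :=
        (hh.integrableOn_compact_subset hφΩ hφc).mul_bdd
          hφ.continuous.aestronglyMeasurable (Eventually.of_forall hB)
      refine (integrableOn_iff_integrable_of_support_subset fun x hx => ?_).1 hK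
      exact subset_tsupport φ (right_ne_zero_of_mul hx)
    have hset : ∀ {h : EuclideanSpace ℝ (Fin d) → ℝ},
        ∫ x in Ω, h x * φ x = ∫ x, h x * φ x := by
      intro h
      refine setIntegral_eq_integral_of_forall_compl_eq_zero fun x hx => ?_
      rw [image_eq_zero_of_notMem_tsupport fun hx' => hx (hφΩ hx'), mul_zero]
    have e := hg.integral_eq φ hφ hφc hφΩ i
    rw [hg'.integral_eq φ hφ hφc hφΩ i, neg_inj, hset, hset] at e
    calc ∫ x, φ x • (g x i - g' x i) = ∫ x, (g x i * φ x - g' x i * φ x) := by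
          refine integral_congr_ae (Eventually.of_forall fun x => ?_)
          simp only [smul_eq_mul]; ring
      _ = 0 := by rw [integral_sub (hmul h1) (hmul h2), e, sub_self]
  rw [EventuallyEq, ae_restrict_iff' hΩ.measurableSet]
  filter_upwards [ae_all_iff.2 hcoord] with x hx hxΩ
  ext i
  exact sub_eq_zero.1 (hx i hxΩ)

/-! ### The Poincaré inequality for Sobolev functions -/

theorem integral_withDensity_restrict_eq {S : Set (EuclideanSpace ℝ (Fin d))}
    (hS : MeasurableSet S) {p : EuclideanSpace ℝ (Fin d) → ℝ} (hpm : Measurable p)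
    (hp₀ : ∀ x ∈ S, 0 ≤ p x) (k : EuclideanSpace ℝ (Fin d) → ℝ) :
    ∫ x, k x ∂(volume.restrict S).withDensity (fun x => ENNReal.ofReal (p x)) =
      ∫ x, k x * S.indicator p x := by
  rw [integral_withDensity_eq_integral_toReal_smul hpm.ennreal_ofReal (by simp),
    ← integral_indicator hS]
  refine integral_congr_ae (Eventually.of_forall fun x => ?_)
  by_cases hx : x ∈ S
  · simp [hx, ENNReal.toReal_ofReal (hp₀ x hx), mul_comm]
  · simp [hx]

/-- The Poincaré inequality for Sobolev functions on a convex set `S` at positive distance from the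
boundary of `Ω`, by mollification. -/
theorem setIntegral_abs_mul_le_of_ball_subset {Ω S : Set (EuclideanSpace ℝ (Fin d))}
    (hΩ : IsOpen Ω) (hΩb : Bornology.IsBounded Ω) {u : EuclideanSpace ℝ (Fin d) → ℝ}
    {g : EuclideanSpace ℝ (Fin d) → EuclideanSpace ℝ (Fin d)} (hug : HasWeakGradientOn Ω u g)
    (hu : IntegrableOn u Ω) (hg : IntegrableOn g Ω)
    (hS : MeasurableSet S) (hSc : Convex ℝ S) {p : EuclideanSpace ℝ (Fin d) → ℝ}
    (hpm : Measurable p) (hp₀ : ∀ x ∈ S, 0 ≤ p x) {M : ℝ} (hM : 0 ≤ M)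
    (hpM : ∀ x ∈ S, p x ≤ M) (hp : LogConcaveOn S p)
    {δ : ℝ} (hδ : 0 < δ) (hSδ : ∀ x ∈ S, Metric.ball x δ ⊆ Ω)
    {D : ℝ} (hD : 0 < D) (hSD : ∀ x ∈ S, ∀ y ∈ S, dist x y ≤ D) :
    ∫ x in S, |u x| * p x ≤
      |∫ x in S, u x * p x| + 2 * D * ∫ x in S, ‖g x‖ * p x := by
  have hSΩ : S ⊆ Ω := fun x hx => hSδ x hx (Metric.mem_ball_self hδ)
  set W := S.indicator p with hW
  have hWm : Measurable W := hpm.indicator hS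
  have hW0 : ∀ x, 0 ≤ W x := fun x => indicator_nonneg hp₀ x
  have hWM : ∀ x, ‖W x‖ ≤ M := by
    intro x
    rw [Real.norm_of_nonneg (hW0 x)]
    by_cases hx : x ∈ S
    · simpa [hW, hx] using hpM x hx
    · simpa [hW, hx] using hM
  have hSfin : volume S < ⊤ := (measure_mono hSΩ).trans_lt hΩb.measure_lt_top
  have hpi : IntegrableOn p S :=
    Measure.integrableOn_of_bounded hSfin.ne hpm.aestronglyMeasurable
      (by
        filter_upwards [ae_restrict_mem hS] with x hx
        rw [Real.norm_of_nonneg (hp₀ x hx)]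
        exact hpM x hx)
  have hWi : Integrable W := hpi.integrable_indicator hS
  have hui : Integrable (Ω.indicator u) := hu.integrable_indicator hΩ.measurableSet
  have hgi : Integrable (Ω.indicator g) := hg.integrable_indicator hΩ.measurableSet
  have huc : HasCompactSupport (Ω.indicator u) :=
    HasCompactSupport.intro hΩb.isCompact_closure fun x hx =>
      indicator_of_notMem (fun h => hx (subset_closure h)) u
  set μ := (volume.restrict S).withDensity fun x => ENNReal.ofReal (p x) with hμ
  have hμint : ∀ k : EuclideanSpace ℝ (Fin d) → ℝ, ∫ x, k x ∂μ = ∫ x, k x * W x :=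
    integral_withDensity_restrict_eq hS hpm hp₀
  have : IsFiniteMeasure μ := isFiniteMeasure_withDensity_ofReal hpi.2
  -- A sequence of mollifiers with radii below `δ`.
  have hr : ∀ n : ℕ, 0 < δ / (2 * (n + 2)) := fun n => by positivity
  set φ : ℕ → ContDiffBump (0 : EuclideanSpace ℝ (Fin d)) := fun n =>
    ⟨δ / (2 * (n + 2)), 2 * (δ / (2 * (n + 2))), hr n, by linarith [hr n]⟩ with hφdef
  have hrOut : ∀ n, (φ n).rOut = δ * (1 / ((n : ℝ) + 2)) := fun n => by
    simp only [hφdef]; field_simp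
  have hφδ : ∀ n, (φ n).rOut < δ := fun n => by
    rw [hrOut]
    have : (1 : ℝ) / (n + 2) < 1 := by
      rw [div_lt_one (by positivity)]; linarith [(Nat.cast_nonneg n : (0 : ℝ) ≤ n)]
    nlinarith
  have hφ : Tendsto (fun n => (φ n).rOut) atTop (𝓝 0) := by
    simp only [hrOut]
    have h := (tendsto_one_div_add_atTop_nhds_zero_nat (𝕜 := ℝ)).comp (tendsto_add_atTop_nat 1)
    have := h.const_mul δ
    rw [mul_zero] at this
    refine this.congr fun n => ?_
    simp only [Function.comp_apply]
    push_cast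
    ring
  have hφK : ∀ᶠ n in atTop, (φ n).rOut ≤ 2 * (φ n).rIn := Eventually.of_forall fun n => le_rfl
  set m : ℕ → EuclideanSpace ℝ (Fin d) → ℝ := fun n =>
    (φ n).normed volume ⋆[ContinuousLinearMap.lsmul ℝ ℝ, volume] Ω.indicator u with hm
  set q : ℕ → EuclideanSpace ℝ (Fin d) → ℝ := fun n =>
    (φ n).normed volume ⋆[ContinuousLinearMap.lsmul ℝ ℝ, volume] fun y => ‖Ω.indicator g y‖ with hq
  have hmC : ∀ n, ContDiff ℝ (1 : ℕ∞) (m n) := fun n =>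
    (φ n).hasCompactSupport_normed.contDiff_convolution_left _ (φ n).contDiff_normed
      hui.locallyIntegrable
  have hmc : ∀ n, HasCompactSupport (m n) := fun n =>
    (φ n).hasCompactSupport_normed.convolution _ huc
  have hmd : ∀ n, Continuous (fderiv ℝ (m n)) := fun n => (hmC n).continuous_fderiv one_ne_zero
  have hmdc : ∀ n, HasCompactSupport (fderiv ℝ (m n)) := fun n => (hmc n).fderiv (𝕜 := ℝ)
  have hbdd : ∀ {k : EuclideanSpace ℝ (Fin d) → ℝ}, Integrable k → Integrable fun x => k x * W x :=
    fun hk => hk.mul_bdd hWm.aestronglyMeasurable (Eventually.of_forall hWM)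
  have hqi : ∀ n, Integrable (q n) := fun n =>
    (φ n).integrable_normed.integrable_convolution _ hgi.norm
  have hineq : ∀ n, ∫ x, ‖m n x * W x‖ ≤ |∫ x, m n x * W x| + 2 * D * ∫ x, q n x * W x := by
    intro n
    have h := integral_abs_le_of_uniformContinuous_fderiv hS hSc hpm hp₀ hp hμ hD hSD
      ((hmC n).differentiable one_ne_zero)
      ((hmdc n).uniformContinuous_of_continuous (hmd n))
      ((hmC n).continuous.integrable_of_hasCompactSupport (hmc n))
      ((hmd n).integrable_of_hasCompactSupport (hmdc n))
    rw [hμint, hμint, hμint] at h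
    have hnorm : ∫ x, ‖m n x * W x‖ = ∫ x, |m n x| * W x :=
      integral_congr_ae (Eventually.of_forall fun x => by
        simp only [norm_mul, Real.norm_of_nonneg (hW0 x), Real.norm_eq_abs])
    rw [hnorm]
    refine h.trans ?_
    gcongr
    · exact hbdd ((hmd n).integrable_of_hasCompactSupport (hmdc n)).norm
    · exact hbdd (hqi n)
    · intro x
      by_cases hx : x ∈ S
      · refine mul_le_mul_of_nonneg_right ?_ (hW0 x)
        exact norm_fderiv_convolution_normed_le hΩ hug hu hg (φ n)
          ((Metric.closedBall_subset_ball (hφδ n)).trans (hSδ x hx))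
      · simp [hW, hx]
  have hlim := (tendsto_integral_convolution_mul hφ hφK hui hWm hWi hWM).abs.add
    ((tendsto_integral_convolution_mul hφ hφK hgi.norm hWm hWi hWM).const_mul (2 * D))
  have hfatou := integral_norm_le_of_tendsto
    (fun n => hbdd ((hmC n).continuous.integrable_of_hasCompactSupport (hmc n))) (hbdd hui)
    (by
      filter_upwards [ContDiffBump.ae_convolution_tendsto_right_of_locallyIntegrable hφ hφK
        hui.locallyIntegrable] with x hx
      exact hx.mul_const _) hineq hlim
  have hback : ∀ k k' : EuclideanSpace ℝ (Fin d) → ℝ, (∀ x ∈ S, k' x = k x * p x) →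
      (∀ x ∉ S, k' x = 0) → ∫ x, k' x = ∫ x in S, k x * p x := by
    intro k k' h1 h2
    rw [← integral_indicator hS]
    refine integral_congr_ae (Eventually.of_forall fun x => ?_)
    by_cases hx : x ∈ S
    · simp [hx, h1 x hx]
    · simp [hx, h2 x hx]
  rw [hback (fun x => |u x|) _ (fun x hx => ?_) (fun x hx => by simp [hW, hx]),
    hback u _ (fun x hx => by simp [hW, hx, hSΩ hx]) (fun x hx => by simp [hW, hx]),
    hback (fun x => ‖g x‖) _ (fun x hx => by simp [hW, hx, hSΩ hx])
      (fun x hx => by simp [hW, hx])] at hfatou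
  · exact hfatou
  · simp [hW, hx, hSΩ hx, abs_of_nonneg (hp₀ x hx)]

/-- The inner parallel set `{x | ball x δ ⊆ Ω}` of a convex set is convex. -/
theorem Convex.compl_thickening_compl {E : Type*} [SeminormedAddCommGroup E] [NormedSpace ℝ E]
    {Ω : Set E} (hΩ : Convex ℝ Ω) (δ : ℝ) : Convex ℝ (Metric.thickening δ Ωᶜ)ᶜ := by
  have hmem : ∀ x, x ∈ (Metric.thickening δ Ωᶜ)ᶜ ↔ ∀ v : E, ‖v‖ < δ → x + v ∈ Ω := by
    intro x
    simp only [mem_compl_iff, Metric.mem_thickening_iff, not_exists, not_and, not_lt]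
    constructor
    · intro h v hv
      by_contra hxv
      have := h (x + v) hxv
      rw [dist_self_add_right] at this
      linarith
    · intro h z hz
      by_contra! hlt
      refine hz ?_
      have := h (z - x) (by rwa [← dist_eq_norm, dist_comm])
      rwa [add_sub_cancel] at this
  intro x hx y hy a b ha hb hab
  rw [hmem] at hx hy ⊢
  intro v hv
  have h : a • x + b • y + v = a • (x + v) + b • (y + v) := by
    rw [smul_add, smul_add, add_add_add_comm, ← add_smul, hab, one_smul]
  rw [h]
  exact hΩ (hx v hv) (hy v hv) ha hb hab

end

theorem lemma4 (d : ℕ) (Ω : Set (EuclideanSpace ℝ (Fin d)))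
    (hΩ_open : IsOpen Ω) (hΩ_convex : Convex ℝ Ω) (hΩ_bdd : Bornology.IsBounded Ω)
    (p : EuclideanSpace ℝ (Fin d) → ℝ)
    (hp_nonneg : ∀ x ∈ Ω, 0 ≤ p x) (hp_logconcave : LogConcaveOn Ω p)
    (hp_smooth : ContDiffOn ℝ 2 p Ω)
    (u : EuclideanSpace ℝ (Fin d) → ℝ) (hu : MemSobolevW11 Ω u)
    (gradu : EuclideanSpace ℝ (Fin d) → EuclideanSpace ℝ (Fin d))
    (hgradu : HasWeakGradientOn Ω u gradu)
    (hmean : ∫ x in Ω, u x * p x = 0) :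
    IntegrableOn (fun x => |u x| * p x) Ω volume ∧
      IntegrableOn (fun x => ‖gradu x‖ * p x) Ω volume ∧
      ∫ x in Ω, |u x| * p x ≤ 2 * Metric.diam Ω * ∫ x in Ω, ‖gradu x‖ * p x := by
  obtain ⟨hui, g, hg, hgi⟩ := hu
  have hgradui : IntegrableOn gradu Ω := hgi.congr (hg.ae_eq hΩ_open hgradu)
  obtain ⟨M, hM, hpM⟩ :=
    hp_logconcave.exists_forall_le hΩ_open hΩ_bdd hp_nonneg hp_smooth.continuousOn
  have hpb : ∀ᵐ x ∂volume.restrict Ω, ‖p x‖ ≤ M := by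
    filter_upwards [ae_restrict_mem hΩ_open.measurableSet] with x hx
    rw [Real.norm_of_nonneg (hp_nonneg x hx)]
    exact hpM x hx
  have hpa : AEStronglyMeasurable p (volume.restrict Ω) :=
    hp_smooth.continuousOn.aestronglyMeasurable hΩ_open.measurableSet
  have hup : IntegrableOn (fun x => u x * p x) Ω := hui.mul_bdd hpa hpb
  have haup : IntegrableOn (fun x => |u x| * p x) Ω := hui.abs.mul_bdd hpa hpb
  have hgp : IntegrableOn (fun x => ‖gradu x‖ * p x) Ω := hgradui.norm.mul_bdd hpa hpb
  refine ⟨haup, hgp, ?_⟩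
  -- A globally measurable version of the weight.
  set P := Ω.indicator p with hP
  have hPm : Measurable P := by
    classical
    rw [hP, ← piecewise_eq_indicator]
    exact hp_smooth.continuousOn.measurable_piecewise continuousOn_const hΩ_open.measurableSet
  have hPp : ∀ x ∈ Ω, P x = p x := fun x hx => indicator_of_mem hx p
  -- Exhaustion of `Ω` by its inner parallel sets, which are convex.
  set S : ℕ → Set (EuclideanSpace ℝ (Fin d)) := fun n =>
    (Metric.thickening (1 / ((n : ℝ) + 1)) Ωᶜ)ᶜ with hSdef
  have hSm : ∀ n, MeasurableSet (S n) := fun n => Metric.isOpen_thickening.measurableSet.compl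
  have hSmono : Monotone S := fun m n hmn => compl_subset_compl.2
    (Metric.thickening_mono (one_div_le_one_div_of_le (by positivity) (by gcongr)) _)
  have hSball : ∀ n, ∀ x ∈ S n, Metric.ball x (1 / ((n : ℝ) + 1)) ⊆ Ω := by
    intro n x hx y hy
    by_contra hyΩ
    exact hx (Metric.mem_thickening_iff.2 ⟨y, hyΩ, by rwa [dist_comm]⟩)
  have hSΩ : ∀ n, S n ⊆ Ω := fun n x hx =>
    hSball n x hx (Metric.mem_ball_self (by positivity))
  have hSU : ⋃ n, S n = Ω := by
    refine subset_antisymm (iUnion_subset hSΩ) fun x hx => ?_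
    obtain ⟨r, hr, hrΩ⟩ := Metric.isOpen_iff.1 hΩ_open x hx
    obtain ⟨n, hn⟩ := exists_nat_one_div_lt hr
    refine mem_iUnion.2 ⟨n, fun hx' => ?_⟩
    obtain ⟨z, hz, hxz⟩ := Metric.mem_thickening_iff.1 hx'
    exact hz (hrΩ (by rw [Metric.mem_ball, dist_comm]; linarith))
  have hlim : ∀ {k : EuclideanSpace ℝ (Fin d) → ℝ}, IntegrableOn k Ω →
      Tendsto (fun n => ∫ x in S n, k x) atTop (𝓝 (∫ x in Ω, k x)) := by
    intro k hk
    have := tendsto_setIntegral_of_monotone hSm hSmono (f := k) (μ := volume) (by rwa [hSU])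
    rwa [hSU] at this
  -- The constant `D` exceeds the diameter, which makes it positive even if `Ω` is a point.
  have hbound : ∀ D > Metric.diam Ω,
      ∫ x in Ω, |u x| * p x ≤ 2 * D * ∫ x in Ω, ‖gradu x‖ * p x := by
    intro D hD
    have hn : ∀ n, ∫ x in S n, |u x| * p x ≤
        |∫ x in S n, u x * p x| + 2 * D * ∫ x in S n, ‖gradu x‖ * p x := by
      intro n
      have h := setIntegral_abs_mul_le_of_ball_subset hΩ_open hΩ_bdd hgradu hui hgradui (hSm n)
        (hΩ_convex.compl_thickening_compl _) hPm
        (fun x hx => (hPp x (hSΩ n hx)).symm ▸ hp_nonneg x (hSΩ n hx)) hM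
        (fun x hx => (hPp x (hSΩ n hx)).symm ▸ hpM x (hSΩ n hx))
        (fun x hx y hy a b ha hb hab => by
          rw [hPp x (hSΩ n hx), hPp y (hSΩ n hy),
            hPp _ (hΩ_convex (hSΩ n hx) (hSΩ n hy) ha.le hb.le hab)]
          exact hp_logconcave (hSΩ n hx) (hSΩ n hy) ha hb hab)
        (by positivity) (hSball n) (Metric.diam_nonneg.trans_lt hD)
        (fun x hx y hy => (Metric.dist_le_diam_of_mem hΩ_bdd (hSΩ n hx) (hSΩ n hy)).trans hD.le)
      have hcongr : ∀ k : EuclideanSpace ℝ (Fin d) → ℝ,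
          ∫ x in S n, k x * P x = ∫ x in S n, k x * p x := fun k =>
        setIntegral_congr_fun (hSm n) fun x hx => by simp only [hPp x (hSΩ n hx)]
      rwa [hcongr, hcongr, hcongr] at h
    have h := le_of_tendsto_of_tendsto' (hlim haup)
      ((hlim hup).abs.add ((hlim hgp).const_mul (2 * D))) hn
    rwa [hmean, abs_zero, zero_add] at h
  have hcont : Tendsto (fun D => 2 * D * ∫ x in Ω, ‖gradu x‖ * p x) (𝓝[>] Metric.diam Ω)
      (𝓝 (2 * Metric.diam Ω * ∫ x in Ω, ‖gradu x‖ * p x)) :=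
    ((by fun_prop : Continuous fun D : ℝ => 2 * D * ∫ x in Ω, ‖gradu x‖ * p x).tendsto _).mono_left
      nhdsWithin_le_nhds
  exact ge_of_tendsto hcont (eventually_nhdsWithin_of_forall hbound)
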